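/- Let $n\ge 0$, $m\ge 1$, $m_H\ge 0$ be integers, let $F=(F_1,\dots,F_m):\mathbb{R}^n\to\mathbb{R}^m$ and $H:\mathbb{R}^n\to\mathbb{R}^{m_H}$ be $C^2$, and let $0$ be a regular value of $H$, i.e. $\operatorname{rk} DH(x)=m_H$ for every $x$ with $H(x)=0$. Put $\mathcal{M}=H^{-1}(\{0\})$, and write $u<w$ for vectors if $u_i<w_i$ for all $i$. A point $x\in\mathbb{R}^n$ is called Pareto critical (on $\mathcal{M}$) if $x\in\mathcal{M}$ and there is no $v\in\ker DH(x)$ with $DF(x)v<0$. For $x\in\mathcal{M}$ let $$\alpha(x)=\min_{v\in\ker DH(x)}\Bigl(\max_{i}\nabla F_i(x)v+\tfrac12\|v\|^2\Bigr),$$ and for $\gamma\in(0,1]$ call $v'$ an approximate solution at $x$ with tolerance $\gamma$ if $v'\in\ker DH(x)$ and $\max_i\nabla F_i(x)v'+\frac12\|v'\|^2\le\gamma\,\alpha(x)$. Let $\pi:\mathbb{R}^n\to\mathcal{M}$ be a map such that, for every $y\in\mathbb{R}^n$, $\pi(y)$ is a point of $\mathcal{M}$ with minimal Euclidean distance to $y$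 (an arbitrary such point where it is not unique). Fix $\gamma\in(0,1]$, $\beta_0>0$, $\beta\in(0,1)$, $\sigma\in(0,1)$ and an input $x\in\mathbb{R}^n$, and consider the following algorithm. Set $x_0=\pi(x)$. For $l=0,1,2,\dots$: compute an approximate solution $v_l$ at $x_l$ with tolerance $\gamma$; if $x_l$ is Pareto critical, stop; otherwise let $k_l$ be the smallest $k\in\{0,1,2,\dots\}$ with $$F(\pi(x_l+\beta_0\beta^k v_l))<F(x_l)+\sigma\beta_0\beta^k DF(x_l)v_l,$$ put $t_l=\beta_0\beta^{k_l}$ and set $x_{l+1}=\pi(x_l+t_lv_l)$. (The sequence also ends at $x_l$ if one of these computations is impossible; that this never happens is part of the assertion.) Then every sequence $(x_l)_l$ generated by this algorithm is either finite, and its last element is Pareto critical, or it is infinite and each of its accumulation points in $\mathbb{R}^n$ is Pareto critical. -/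

import Mathlib

open Filter Topology

noncomputable section

namespace EqMOP

/-- `ℝⁿ` with the Euclidean norm. -/
abbrev E (n : ℕ) : Type := EuclideanSpace ℝ (Fin n)

variable {n m mH : ℕ}

/-- The feasible set `M = H⁻¹({0})`. -/
def feasible (H : E n → E mH) : Set (E n) := {x | H x = 0}

/-- `0` is a regular value of `H`: the derivative `DH(x)` has rank `mH` whenever `H x = 0`. -/
def ZeroIsRegularValue (H : E n → E mH) : Prop :=
  ∀ x : E n, H x = 0 →
    Module.finrank ℝ (LinearMap.range (fderiv ℝ H x : E n →ₗ[ℝ] E mH)) = mH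

/-- The tangent space `ker DH(x)`. -/
def tangent (H : E n → E mH) (x : E n) : Submodule ℝ (E n) :=
  LinearMap.ker (fderiv ℝ H x : E n →ₗ[ℝ] E mH)

/-- `x` is Pareto critical on `M`: it is feasible and there is no `v ∈ ker DH(x)`
with `DF(x) v < 0` in every component. -/
def IsParetoCritical (F : E n → E m) (H : E n → E mH) (x : E n) : Prop :=
  x ∈ feasible H ∧ ¬ ∃ v ∈ tangent H x, ∀ i : Fin m, (fderiv ℝ F x v) i < 0

/-- The objective `max_i ∇F_i(x) v + ‖v‖² / 2` of the direction subproblem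
(the supremum is a maximum over the finite index set, which is non-empty when `m ≥ 1`). -/
def dirObj (F : E n → E m) (x v : E n) : ℝ :=
  (⨆ i : Fin m, (fderiv ℝ F x v) i) + (1 / 2) * ‖v‖ ^ 2

/-- The optimal value `α(x)` of the direction subproblem over `v ∈ ker DH(x)`
(the objective is bounded below, so that the infimum is the genuine one). -/
def alpha (F : E n → E m) (H : E n → E mH) (x : E n) : ℝ :=
  ⨅ v : tangent H x, dirObj F x (v : E n)

/-- `v` is an approximate solution of the direction subproblem at `x` with tolerance `γ`. -/
def IsApproxSol (F : E n → E m) (H : E n → E mH) (γ : ℝ) (x v : E n) : Prop :=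
  v ∈ tangent H x ∧ dirObj F x v ≤ γ * alpha F H x

/-- The set `P_M(y)` of the points of `M` nearest to `y`. -/
def nearest (M : Set (E n)) (y : E n) : Set (E n) :=
  {x | x ∈ M ∧ ∀ z ∈ M, ‖x - y‖ ≤ ‖z - y‖}

/-- `π` is a nearest-point projection onto `M`: `π y` is the nearest point of `M` where that is
unique, and some nearest point otherwise. -/
def IsNearestProj (M : Set (E n)) (π : E n → E n) : Prop :=
  ∀ y : E n, π y ∈ nearest M y

/-- The Armijo inequality for the step length `s` (in every component). -/
def Armijo (F : E n → E m) (π : E n → E n) (σ : ℝ) (x v : E n) (s : ℝ) : Prop :=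
  ∀ i : Fin m, (F (π (x + s • v))) i < (F x) i + σ * s * (fderiv ℝ F x v) i

/-- `t = β₀ βᵏ` with the smallest `k` for which the Armijo inequality holds. -/
def IsStepLength (F : E n → E m) (π : E n → E n) (β₀ β σ : ℝ) (x v : E n) (t : ℝ) : Prop :=
  ∃ k : ℕ, IsLeast {j : ℕ | Armijo F π σ x v (β₀ * β ^ j)} k ∧ t = β₀ * β ^ k

/-- One full iteration from the iterate `x` with direction `v`: `x` is not Pareto critical, `v` is
an approximate solution, the step length `t` is computed and `y = π (x + t v)`. -/
def Step (F : E n → E m) (H : E n → E mH) (π : E n → E n) (γ β₀ β σ : ℝ) (x v y : E n) : Prop :=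
  ¬ IsParetoCritical F H x ∧ IsApproxSol F H γ x v ∧
    ∃ t : ℝ, IsStepLength F π β₀ β σ x v t ∧ y = π (x + t • v)

/-- A run of the descent method from the input `xin`. The generated sequence is
`x 0, x 1, …, x N` if `N` is finite, and `(x l)` for all `l` if `N = ⊤`; in the first case the
values of `x` and `v` after `N` play no role.

A run ends only where no further iteration can be carried out. That its last element is Pareto
critical is not part of the definition: the method might also have broken down because there is no
approximate solution or no admissible step length. -/
structure IsRun (F : E n → E m) (H : E n → E mH) (π : E n → E n) (γ β₀ β σ : ℝ) (xin : E n)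
    (N : ℕ∞) (x v : ℕ → E n) : Prop where
  init : x 0 = π xin
  /-- an approximate solution is chosen as direction at every iterate that admits one -/
  direction : ∀ l : ℕ, (l : ℕ∞) ≤ N → (∃ w, IsApproxSol F H γ (x l) w) →
    IsApproxSol F H γ (x l) (v l)
  step : ∀ l : ℕ, (l : ℕ∞) < N → Step F H π γ β₀ β σ (x l) (v l) (x (l + 1))
  maximal : ∀ l : ℕ, (l : ℕ∞) = N → ¬ ∃ y, Step F H π γ β₀ β σ (x l) (v l) y

end EqMOP

end

namespace EqMOP

open Metric Set

/-! Suppose `a` is feasible but not Pareto critical. Tangent spaces vary continuously because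
`DH(a)` is onto, so a descent direction at `a` perturbs to nearby points and `alpha` stays below a
negative constant (`eventually_alpha_le`). A tangential step of length `s` leaves `M` by only
`o(s)`, and metric regularity of `H` makes the projection correction `o(s)` too
(`norm_proj_sub_le`). Hence small steps pass the Armijo test uniformly near `a`
(`eventually_armijo`), and backtracking keeps step lengths bounded below. At `a` itself this shows
that the method cannot break down. If `a` is an accumulation point, every visit near `a` lowers the
objectives by a fixed amount, which contradicts monotone decrease towards `F(a)`. -/

/-! ### Quantitative surjectivity and uniform Taylor estimates. -/

/-- A map that is close to a surjective linear map has a zero near every point where it is small. -/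
theorem exists_zero_near {X Y : Type*} [NormedAddCommGroup X] [NormedSpace ℝ X] [CompleteSpace X]
    [NormedAddCommGroup Y] [NormedSpace ℝ Y] [CompleteSpace Y] (A : X →L[ℝ] Y)
    (hA : A.range = ⊤) :
    ∃ C : ℝ, 0 < C ∧ ∃ c : NNReal, 0 < c ∧ ∀ (f : X → Y) (s : Set X),
      ApproximatesLinearOn f A s c → ∀ y, closedBall y (C * ‖f y‖) ⊆ s →
        ∃ z, f z = 0 ∧ ‖z - y‖ ≤ C * ‖f y‖ := by
  set R := A.nonlinearRightInverseOfSurjective hA with hR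
  have hpos : 0 < R.nnnorm := A.nonlinearRightInverseOfSurjective_nnnorm_pos hA
  have hpos' : (0 : ℝ) < R.nnnorm := hpos
  -- With this `c`, a ball of radius `ρ` about `y` has image covering the ball of radius `ρ /
  -- (2‖R‖)` about `f y`; `ρ = 2‖R‖‖f y‖` just reaches `0`.
  refine ⟨2 * R.nnnorm, by positivity, R.nnnorm⁻¹ / 2, by positivity, fun f s hf y hy => ?_⟩
  have h := hf.surjOn_closedBall_of_nonlinearRightInverse R (by positivity) hy
  obtain ⟨z, hz, hz0⟩ := h (show (0 : Y) ∈ _ by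
    rw [mem_closedBall, dist_zero_left]
    apply le_of_eq
    push_cast
    field_simp
    ring)
  exact ⟨z, hz0, by rwa [mem_closedBall, dist_eq_norm] at hz⟩

/-- A `C¹` map is approximated to first order, uniformly near each point. -/
theorem eventually_taylor {X Y : Type*} [NormedAddCommGroup X] [NormedSpace ℝ X]
    [NormedAddCommGroup Y] [NormedSpace ℝ Y] {f : X → Y} (hf : ContDiff ℝ 2 f) (a : X)
    {ε : ℝ} (hε : 0 < ε) :
    ∃ r > 0, ∀ x ∈ ball a r, ∀ y ∈ ball a r,
      ‖f y - f x - fderiv ℝ f x (y - x)‖ ≤ ε * ‖y - x‖ := by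
  have hs : HasStrictFDerivAt f (fderiv ℝ f a) a :=
    hf.contDiffAt.hasStrictFDerivAt (by norm_num)
  obtain ⟨s, hs, happ⟩ := hs.approximates_deriv_on_nhds
    (c := (ε / 2).toNNReal) (Or.inr (Real.toNNReal_pos.2 (half_pos hε)))
  have hc : ∀ᶠ x in 𝓝 a, dist (fderiv ℝ f x) (fderiv ℝ f a) < ε / 2 :=
    ((hf.continuous_fderiv (by norm_num)).tendsto a).eventually (ball_mem_nhds _ (by positivity))
  obtain ⟨r, hr, hball⟩ := Metric.mem_nhds_iff.1 (inter_mem hs hc)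
  refine ⟨r, hr, fun x hx y hy => ?_⟩
  have h1 := happ y (hball hy).1 x (hball hx).1
  rw [Real.coe_toNNReal _ (half_pos hε).le] at h1
  have h2 : ‖fderiv ℝ f a - fderiv ℝ f x‖ ≤ ε / 2 := by
    rw [← dist_eq_norm, dist_comm]; exact (hball hx).2.le
  have h3 := (fderiv ℝ f a - fderiv ℝ f x).le_of_opNorm_le h2 (y - x)
  calc _ = ‖(f y - f x - fderiv ℝ f a (y - x))
          + (fderiv ℝ f a - fderiv ℝ f x) (y - x)‖ := by
        congr 1; simp only [sub_apply]; abel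
    _ ≤ _ := norm_add_le _ _
    _ ≤ ε / 2 * ‖y - x‖ + ε / 2 * ‖y - x‖ := add_le_add h1 h3
    _ = _ := by ring

/-! ### Geometry of the feasible set. -/

variable {n m mH : ℕ}

theorem ZeroIsRegularValue.range_eq_top {H : E n → E mH} (hreg : ZeroIsRegularValue H) {x : E n}
    (hx : x ∈ feasible H) : (fderiv ℝ H x).range = ⊤ := by
  apply Submodule.eq_top_of_finrank_eq
  rw [finrank_euclideanSpace_fin]
  exact hreg x hx

/-- Nearest-point projection moves tangential steps only to second order, uniformly near a feasible
point. -/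
theorem norm_proj_sub_le {H : E n → E mH} (hH : ContDiff ℝ 2 H) (hreg : ZeroIsRegularValue H)
    {π : E n → E n} (hπ : IsNearestProj (feasible H) π) {a : E n} (ha : a ∈ feasible H)
    (R : ℝ) {η : ℝ} (hη : 0 < η) :
    ∃ r > 0, ∀ x ∈ ball a r, x ∈ feasible H → ∀ v ∈ tangent H x, ‖v‖ ≤ R →
      ∀ s : ℝ, 0 < s → s < r → ‖π (x + s • v) - (x + s • v)‖ ≤ η * s := by
  obtain ⟨C, hC, c, hc, hz⟩ := exists_zero_near (fderiv ℝ H a) (hreg.range_eq_top ha)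
  have hs : HasStrictFDerivAt H (fderiv ℝ H a) a :=
    hH.contDiffAt.hasStrictFDerivAt (by norm_num)
  obtain ⟨U, hU, happ⟩ := hs.approximates_deriv_on_nhds (Or.inr hc)
  obtain ⟨ρ, hρ, hρU⟩ := Metric.mem_nhds_iff.1 hU
  have hε : 0 < η / (C * (|R| + 1)) := by positivity
  obtain ⟨r₁, hr₁, ht⟩ := eventually_taylor hH a hε
  have hlim : ∀ᶠ y in 𝓝 a, C * ‖H y‖ < ρ / 2 := by
    have : Tendsto (fun y => C * ‖H y‖) (𝓝 a) (𝓝 (C * ‖H a‖)) :=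
      (continuous_const.mul hH.continuous.norm).tendsto a
    rw [show H a = 0 from ha, norm_zero, mul_zero] at this
    exact this.eventually (gt_mem_nhds (by positivity))
  obtain ⟨r₂, hr₂, hlim⟩ := Metric.eventually_nhds_iff_ball.1 hlim
  set q := min (ρ / 2) (min r₁ r₂) with hq
  have hq0 : 0 < q := by positivity
  have hq1 : q ≤ ρ / 2 := min_le_left _ _
  have hq2 : q ≤ r₁ := (min_le_right _ _).trans (min_le_left _ _)
  have hq3 : q ≤ r₂ := (min_le_right _ _).trans (min_le_right _ _)
  -- This radius keeps both `x` and `x + s • v` within `q` of `a`.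
  refine ⟨q / (|R| + 2), by positivity, fun x hx hxM v hv hvR s hs hsr => ?_⟩
  rw [lt_div_iff₀ (by positivity)] at hsr
  rw [mem_ball, dist_eq_norm, lt_div_iff₀ (by positivity)] at hx
  have hvR' : ‖v‖ ≤ |R| := hvR.trans (le_abs_self R)
  have hR0 := abs_nonneg R
  have hxa : ‖x - a‖ ≤ q / 2 := by nlinarith [norm_nonneg (x - a)]
  have hsv : ‖s • v‖ ≤ s * |R| := by
    rw [norm_smul, Real.norm_of_nonneg hs.le]; gcongr
  have hya : ‖x + s • v - a‖ < q := by
    have h1 : ‖x + s • v - a‖ ≤ ‖x - a‖ + ‖s • v‖ := by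
      rw [show x + s • v - a = (x - a) + s • v by abel]; exact norm_add_le _ _
    have h2 : ‖x - a‖ * (|R| + 2) + s * (|R| + 2) < 2 * q := by linarith
    by_contra hcon
    push Not at hcon
    have h3 : q ≤ ‖x - a‖ + s * |R| := by linarith
    have h4 : ‖x - a‖ * |R| ≥ 0 := by positivity
    nlinarith
  set y := x + s • v with hy
  -- Both `H x` and `DH(x) v` vanish, so `H y` is pure Taylor remainder. A zero of `H` then lies
  -- within `C‖H y‖` of `y`, and `π y` is no farther.
  have hHy : ‖H y‖ ≤ η / (C * (|R| + 1)) * (s * |R|) := by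
    have h1 := ht x (by rw [mem_ball, dist_eq_norm]; linarith) y
      (by rw [mem_ball, dist_eq_norm]; linarith)
    have h2 : fderiv ℝ H x v = 0 := hv
    have h3 : H x = 0 := hxM
    rw [h3, show y - x = s • v by rw [hy]; abel, map_smul, h2, smul_zero, sub_zero, sub_zero] at h1
    exact h1.trans (by gcongr)
  obtain ⟨z, hz0, hzy⟩ := hz H U happ y (by
    refine Subset.trans (fun w hw => ?_) hρU
    have h1 := hlim y (by rw [mem_ball, dist_eq_norm]; linarith)
    rw [mem_closedBall, dist_eq_norm] at hw
    rw [mem_ball, dist_eq_norm]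
    have : ‖w - a‖ ≤ ‖w - y‖ + ‖y - a‖ := norm_sub_le_norm_sub_add_norm_sub w y a
    linarith)
  calc ‖π y - y‖ ≤ ‖z - y‖ := (hπ y).2 z hz0
    _ ≤ C * ‖H y‖ := hzy
    _ ≤ C * (η / (C * (|R| + 1)) * (s * |R|)) := by gcongr
    _ = η * s * (|R| / (|R| + 1)) := by field_simp
    _ ≤ η * s * 1 := by gcongr; rw [div_le_one (by positivity)]; linarith
    _ = η * s := mul_one _

/-- Tangent vectors at a feasible point are limits of tangent vectors at nearby points. -/
theorem eventually_exists_tangent {H : E n → E mH} (hH : ContDiff ℝ 2 H)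
    (hreg : ZeroIsRegularValue H) {a : E n} (ha : a ∈ feasible H) {w : E n} (hw : w ∈ tangent H a)
    {δ : ℝ} (hδ : 0 < δ) : ∀ᶠ x in 𝓝 a, ∃ u ∈ tangent H x, ‖u - w‖ < δ := by
  obtain ⟨C, hC, c, hc, hz⟩ := exists_zero_near (fderiv ℝ H a) (hreg.range_eq_top ha)
  have hcont := hH.continuous_fderiv (by norm_num)
  have h1 : ∀ᶠ x in 𝓝 a, dist (fderiv ℝ H x) (fderiv ℝ H a) < c :=
    (hcont.tendsto a).eventually (ball_mem_nhds _ hc)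
  have h2 : ∀ᶠ x in 𝓝 a, C * ‖fderiv ℝ H x w‖ < δ := by
    have : Tendsto (fun x => C * ‖fderiv ℝ H x w‖) (𝓝 a) (𝓝 (C * ‖fderiv ℝ H a w‖)) :=
      (continuous_const.mul (hcont.clm_apply continuous_const).norm).tendsto a
    rw [show fderiv ℝ H a w = 0 from hw, norm_zero, mul_zero] at this
    exact this.eventually (gt_mem_nhds hδ)
  filter_upwards [h1, h2] with x hx1 hx2
  -- Here the perturbed map is the linear map `DH(x)` itself, so its zeros are tangent vectors at
  -- `x`.
  obtain ⟨u, hu, huw⟩ := hz (fderiv ℝ H x) univ (fun y _ z _ => by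
    rw [dist_eq_norm] at hx1
    rw [← map_sub, ← sub_apply]
    exact ContinuousLinearMap.le_of_opNorm_le _ hx1.le _) w (subset_univ _)
  exact ⟨u, hu, huw.trans_lt hx2⟩

/-! ### The direction subproblem. -/

theorem fderiv_apply_le_iSup (F : E n → E m) (x v : E n) (i : Fin m) :
    (fderiv ℝ F x v) i ≤ ⨆ i : Fin m, (fderiv ℝ F x v) i :=
  le_ciSup (f := fun i => (fderiv ℝ F x v) i) (Set.finite_range _).bddAbove i

theorem fderiv_apply_le_dirObj (F : E n → E m) (x v : E n) (i : Fin m) :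
    (fderiv ℝ F x v) i ≤ dirObj F x v := by
  have := fderiv_apply_le_iSup F x v i
  unfold dirObj
  nlinarith [sq_nonneg ‖v‖]

theorem dirObj_zero (F : E n → E m) (x : E n) : dirObj F x 0 = 0 := by
  simp [dirObj]

theorem le_dirObj (hm : 1 ≤ m) (F : E n → E m) (x v : E n) :
    -(‖fderiv ℝ F x‖ * ‖v‖) + (1 / 2) * ‖v‖ ^ 2 ≤ dirObj F x v := by
  have h1 := fderiv_apply_le_iSup F x v ⟨0, hm⟩
  have h2 := (PiLp.norm_apply_le (fderiv ℝ F x v) ⟨0, hm⟩).trans ((fderiv ℝ F x).le_opNorm v)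
  rw [Real.norm_eq_abs] at h2
  have h3 := (abs_le.1 h2).1
  unfold dirObj
  linarith

theorem norm_le_of_dirObj_nonpos (hm : 1 ≤ m) {F : E n → E m} {x v : E n}
    (h : dirObj F x v ≤ 0) : ‖v‖ ≤ 2 * ‖fderiv ℝ F x‖ := by
  have h1 := le_dirObj hm F x v
  rcases (norm_nonneg v).eq_or_lt with h0 | h0
  · rw [← h0]; positivity
  · by_contra hcon
    push Not at hcon
    nlinarith

theorem alpha_le (hm : 1 ≤ m) (F : E n → E m) (H : E n → E mH) {x v : E n}
    (hv : v ∈ tangent H x) : alpha F H x ≤ dirObj F x v := by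
  refine ciInf_le (f := fun v : tangent H x => dirObj F x (v : E n))
    ⟨-(1 / 2 * ‖fderiv ℝ F x‖ ^ 2), ?_⟩ ⟨v, hv⟩
  rintro _ ⟨w, rfl⟩
  have := le_dirObj hm F x w
  dsimp only
  nlinarith [sq_nonneg (‖fderiv ℝ F x‖ - ‖(w : E n)‖)]

theorem alpha_nonpos (hm : 1 ≤ m) (F : E n → E m) (H : E n → E mH) (x : E n) :
    alpha F H x ≤ 0 :=
  (alpha_le hm F H (zero_mem _)).trans_eq (dirObj_zero F x)

theorem continuous_dirObj (hm : 1 ≤ m) (F : E n → E m) (x : E n) :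
    Continuous (dirObj F x) := by
  have : Nonempty (Fin m) := ⟨⟨0, hm⟩⟩
  have h : ∀ v, ⨆ i : Fin m, (fderiv ℝ F x v) i
      = Finset.univ.sup' Finset.univ_nonempty fun i : Fin m => (fderiv ℝ F x v) i :=
    fun v => (Finset.sup'_univ_eq_ciSup _).symm
  unfold dirObj
  simp only [h]
  refine Continuous.add (Continuous.finset_sup'_apply _ fun i _ => ?_) (by fun_prop)
  fun_prop

/-- The objective is continuous and exceeds its value at `0` outside a bounded set, so a minimiser
exists; as `α ≤ 0` and `γ ≤ 1`, it meets the tolerance. -/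
theorem exists_isApproxSol (hm : 1 ≤ m) (F : E n → E m) (H : E n → E mH) {γ : ℝ}
    (hγ : γ ≤ 1) (x : E n) : ∃ v, IsApproxSol F H γ x v := by
  obtain ⟨v, hv⟩ := Continuous.exists_forall_le'
    (f := fun v : tangent H x => dirObj F x (v : E n))
    ((continuous_dirObj hm F x).comp continuous_subtype_val) 0 (by
      filter_upwards [(tendsto_norm_cocompact_atTop (E := tangent H x)).eventually_gt_atTop
        (2 * ‖fderiv ℝ F x‖)] with v hv
      rw [ZeroMemClass.coe_zero, dirObj_zero]
      by_contra hcon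
      push Not at hcon
      exact absurd (norm_le_of_dirObj_nonpos hm hcon.le) (not_le.2 hv))
  have h1 : dirObj F x v ≤ alpha F H x := le_ciInf hv
  exact ⟨v, v.2, h1.trans (by nlinarith [alpha_nonpos hm F H x])⟩

/-- Near a feasible point that is not Pareto critical, `α` is bounded away from `0`. -/
theorem eventually_alpha_le (hm : 1 ≤ m) {F : E n → E m} {H : E n → E mH}
    (hF : ContDiff ℝ 2 F) (hH : ContDiff ℝ 2 H) (hreg : ZeroIsRegularValue H) {a : E n}
    (ha : a ∈ feasible H) (hcrit : ¬ IsParetoCritical F H a) :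
    ∃ c > 0, ∀ᶠ x in 𝓝 a, alpha F H x ≤ -c := by
  have : Nonempty (Fin m) := ⟨⟨0, hm⟩⟩
  obtain ⟨v, hv, hneg⟩ : ∃ v ∈ tangent H a, ∀ i : Fin m, (fderiv ℝ F a v) i < 0 := by
    by_contra h; exact hcrit ⟨ha, h⟩
  obtain ⟨i₀, hi₀⟩ := Finite.exists_max fun i : Fin m => (fderiv ℝ F a v) i
  obtain ⟨b, hb, hvb⟩ : ∃ b > 0, ∀ i, (fderiv ℝ F a v) i ≤ -b :=
    ⟨-(fderiv ℝ F a v) i₀, by linarith [hneg i₀], fun i => by linarith [hi₀ i]⟩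
  -- At `s • v` the linear part is at most `-sb` and the squared norm is below `sb`. Relaxing these
  -- to `-7sb/8` and `5sb/4` nearby still leaves `-sb/4`.
  set s : ℝ := b / (‖v‖ ^ 2 + 1) with hs
  have hs0 : 0 < s := by positivity
  have hsv : s * (‖v‖ ^ 2 + 1) = b := by rw [hs]; field_simp
  have hcont : Continuous fun p : E n × E n => fderiv ℝ F p.1 p.2 :=
    ((hF.continuous_fderiv (by norm_num)).comp continuous_fst).clm_apply continuous_snd
  have hev : ∀ᶠ p : E n × E n in 𝓝 (a, s • v), (∀ i, (fderiv ℝ F p.1 p.2) i < -(s * b) * (7 / 8)) ∧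
      ‖p.2‖ ^ 2 < s * b * (5 / 4) := by
    refine (eventually_all.2 fun i => ?_).and ?_
    · have hi : Continuous fun p : E n × E n => (fderiv ℝ F p.1 p.2) i :=
        (EuclideanSpace.proj (𝕜 := ℝ) i).continuous.comp hcont
      refine (hi.tendsto (a, s • v)).eventually (gt_mem_nhds ?_)
      have : (fderiv ℝ F a (s • v)) i = s * (fderiv ℝ F a v) i := by
        rw [map_smul]; rfl
      dsimp only
      rw [this]
      nlinarith [mul_le_mul_of_nonneg_left (hvb i) hs0.le, mul_pos hs0 hb]
    · have hi : Continuous fun p : E n × E n => ‖p.2‖ ^ 2 := by fun_prop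
      refine (hi.tendsto (a, s • v)).eventually (gt_mem_nhds ?_)
      dsimp only
      rw [norm_smul, Real.norm_of_nonneg hs0.le]
      nlinarith [mul_pos hs0 hb, mul_pos hs0 hs0]
  obtain ⟨r, hr, hball⟩ := Metric.eventually_nhds_iff_ball.1 hev
  refine ⟨s * b / 4, by positivity, ?_⟩
  filter_upwards [ball_mem_nhds a hr,
    eventually_exists_tangent hH hreg ha ((tangent H a).smul_mem s hv) hr] with x hx ⟨u, hu, hus⟩
  obtain ⟨h1, h2⟩ := hball (x, u) (by
    rw [← ball_prod_same]; exact ⟨hx, by rwa [mem_ball, dist_eq_norm]⟩)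
  refine (alpha_le hm F H hu).trans ?_
  have h3 : ⨆ i : Fin m, (fderiv ℝ F x u) i ≤ -(s * b) * (7 / 8) := ciSup_le fun i => (h1 i).le
  unfold dirObj
  dsimp only at h2
  linarith

/-! ### Armijo steps and uniform decrease. -/

/-- Near a feasible point that is not Pareto critical, approximate solutions are uniform descent
directions, along which all sufficiently small steps satisfy the Armijo inequality. -/
theorem eventually_armijo (hm : 1 ≤ m) {F : E n → E m} {H : E n → E mH}
    (hF : ContDiff ℝ 2 F) (hH : ContDiff ℝ 2 H) (hreg : ZeroIsRegularValue H)
    {π : E n → E n} (hπ : IsNearestProj (feasible H) π) {γ σ : ℝ} (hγ : 0 < γ) (hσ : σ < 1)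
    {a : E n} (ha : a ∈ feasible H) (hcrit : ¬ IsParetoCritical F H a) :
    ∃ c > 0, ∃ δ > 0, ∀ᶠ x in 𝓝 a, x ∈ feasible H → ∀ v, IsApproxSol F H γ x v →
      (∀ i, (fderiv ℝ F x v) i ≤ -c) ∧ ∀ s, 0 < s → s < δ → Armijo F π σ x v s := by
  obtain ⟨c, hc, halpha⟩ := eventually_alpha_le hm hF hH hreg ha hcrit
  set K := ‖fderiv ℝ F a‖ + 1 with hK
  have hK0 : 0 < K := by positivity
  have hκ : 0 < (1 - σ) * (γ * c) := mul_pos (by linarith) (by positivity)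
  -- `κ` is the Armijo slack per unit step; `η` and `ε` limit the projection and Taylor errors to a
  -- quarter of it each.
  set κ := (1 - σ) * (γ * c) with hκdef
  set η := min 1 (κ / (4 * K)) with hη
  have hη0 : 0 < η := by positivity
  have hη1 : η ≤ 1 := min_le_left _ _
  have hηK : K * η ≤ κ / 4 := by
    have : η ≤ κ / (4 * K) := min_le_right _ _
    rw [le_div_iff₀ (by positivity)] at this
    linarith
  set ε := κ / (4 * (2 * K + 1)) with hε
  have hε0 : 0 < ε := by positivity
  have hεK : ε * (2 * K + 1) = κ / 4 := by rw [hε]; field_simp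
  obtain ⟨r₁, hr₁, htaylor⟩ := eventually_taylor hF a hε0
  obtain ⟨r₂, hr₂, hproj⟩ := norm_proj_sub_le hH hreg hπ ha (2 * K) hη0
  have hnorm : ∀ᶠ x in 𝓝 a, ‖fderiv ℝ F x‖ < K :=
    ((hF.continuous_fderiv (by norm_num)).norm.tendsto a).eventually
      (gt_mem_nhds (lt_add_one _))
  refine ⟨γ * c, by positivity, min r₂ (r₁ / (2 * (2 * K + 1))), by positivity, ?_⟩
  filter_upwards [halpha, hnorm, ball_mem_nhds a hr₂, ball_mem_nhds a (half_pos hr₁)]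
    with x hxα hxK hxr₂ hxr₁ hxM v hv
  have hγα : γ * alpha F H x ≤ -(γ * c) := by nlinarith
  have hdesc : ∀ i, (fderiv ℝ F x v) i ≤ -(γ * c) := fun i =>
    ((fderiv_apply_le_dirObj F x v i).trans hv.2).trans hγα
  refine ⟨hdesc, fun s hs hsδ i => ?_⟩
  have hsr₂ : s < r₂ := hsδ.trans_le (min_le_left _ _)
  have hsr₁ : s < r₁ / (2 * (2 * K + 1)) := hsδ.trans_le (min_le_right _ _)
  rw [lt_div_iff₀ (by positivity)] at hsr₁
  have hvK : ‖v‖ ≤ 2 * K := by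
    have h0 : dirObj F x v ≤ 0 := (hv.2.trans hγα).trans (by nlinarith [mul_pos hγ hc])
    linarith [norm_le_of_dirObj_nonpos hm h0]
  have hp := hproj x hxr₂ hxM v hv.1 hvK s hs hsr₂
  set p := π (x + s • v) with hpdef
  set e := p - (x + s • v) with he
  have hpx : p - x = s • v + e := by rw [he]; abel
  have hpx_norm : ‖p - x‖ ≤ s * (2 * K + 1) := by
    rw [hpx]
    refine (norm_add_le _ _).trans ?_
    rw [norm_smul, Real.norm_of_nonneg hs.le]
    nlinarith
  have hxa : ‖x - a‖ < r₁ / 2 := by rwa [mem_ball, dist_eq_norm] at hxr₁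
  have hpa : ‖p - a‖ < r₁ := by
    have := norm_sub_le_norm_sub_add_norm_sub p x a
    linarith
  have ht := htaylor x (by rw [mem_ball, dist_eq_norm]; linarith) p
    (by rwa [mem_ball, dist_eq_norm])
  have hti := (PiLp.norm_apply_le _ i).trans ht
  have hei := ((PiLp.norm_apply_le (fderiv ℝ F x e) i).trans
    ((fderiv ℝ F x).le_of_opNorm_le hxK.le e)).trans (mul_le_mul_of_nonneg_left hp hK0.le)
  rw [hpx, map_add, map_smul, ← hpx] at hti
  simp only [PiLp.sub_apply, PiLp.add_apply, PiLp.smul_apply, smul_eq_mul] at hti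
  rw [Real.norm_eq_abs] at hti hei
  have h1 := (abs_le.1 hti).2
  have h2 := (abs_le.1 hei).2
  have h3 : ε * ‖p - x‖ ≤ s * (κ / 4) := by
    rw [← hεK]; nlinarith
  have h4 : K * (η * s) ≤ s * (κ / 4) := by nlinarith
  have h5 : (1 - σ) * s * (fderiv ℝ F x v) i ≤ -(s * κ) := by
    have := mul_le_mul_of_nonneg_left (hdesc i) (mul_nonneg (sub_nonneg.2 hσ.le) hs.le)
    rw [hκdef]
    linarith
  have h6 : 0 < s * κ := mul_pos hs hκ
  linarith

theorem exists_isStepLength {F : E n → E m} {π : E n → E n} {β₀ β σ δ : ℝ} {x v : E n}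
    (hβ₀ : 0 < β₀) (hβ : β ∈ Ioo (0 : ℝ) 1) (hδ : 0 < δ)
    (h : ∀ s, 0 < s → s < δ → Armijo F π σ x v s) : ∃ t, IsStepLength F π β₀ β σ x v t := by
  classical
  obtain ⟨k, hk⟩ := exists_pow_lt_of_lt_one (div_pos hδ hβ₀) hβ.2
  rw [lt_div_iff₀ hβ₀] at hk
  have hex : ∃ j, Armijo F π σ x v (β₀ * β ^ j) :=
    ⟨k, h _ (mul_pos hβ₀ (pow_pos hβ.1 _)) (by linarith)⟩
  exact ⟨_, Nat.find hex, ⟨Nat.find_spec hex, fun j hj => Nat.find_min' hex hj⟩, rfl⟩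

/-- Either the first trial `β₀` is accepted, or the trial just before `t`, namely `t / β`, was
rejected and so is at least `δ`. -/
theorem IsStepLength.le {F : E n → E m} {π : E n → E n} {β₀ β σ δ t : ℝ} {x v : E n}
    (hβ₀ : 0 < β₀) (hβ : β ∈ Ioo (0 : ℝ) 1)
    (h : ∀ s, 0 < s → s < δ → Armijo F π σ x v s) (ht : IsStepLength F π β₀ β σ x v t) :
    min β₀ (β * δ) ≤ t := by
  obtain ⟨k, hk, rfl⟩ := ht
  rcases k with _ | k
  · simp
  · refine (min_le_right _ _).trans ?_
    have h1 : δ ≤ β₀ * β ^ k := by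
      by_contra hcon
      push Not at hcon
      have := hk.2 (h _ (mul_pos hβ₀ (pow_pos hβ.1 _)) hcon)
      omega
    calc β * δ ≤ β * (β₀ * β ^ k) := mul_le_mul_of_nonneg_left h1 hβ.1.le
      _ = β₀ * β ^ (k + 1) := by ring

/-- Every step strictly decreases all objectives. -/
theorem Step.lt (hm : 1 ≤ m) {F : E n → E m} {H : E n → E mH} {π : E n → E n}
    {γ β₀ β σ : ℝ} (hγ : 0 < γ) (hβ₀ : 0 < β₀) (hβ : 0 < β) (hσ : 0 < σ) {x v y : E n}
    (h : Step F H π γ β₀ β σ x v y) (i : Fin m) : F y i < F x i := by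
  obtain ⟨-, hv, t, ⟨k, hk, rfl⟩, rfl⟩ := h
  refine (hk.1 i).trans_le ?_
  have h1 : (fderiv ℝ F x v) i ≤ 0 := by
    refine ((fderiv_apply_le_dirObj F x v i).trans hv.2).trans ?_
    exact mul_nonpos_of_nonneg_of_nonpos hγ.le (alpha_nonpos hm F H x)
  have h2 : 0 < σ * (β₀ * β ^ k) := by positivity
  nlinarith

/-- Every step from a feasible point near a point that is not Pareto critical decreases the
objectives by a fixed amount. -/
theorem eventually_step_le (hm : 1 ≤ m) {F : E n → E m} {H : E n → E mH}
    (hF : ContDiff ℝ 2 F) (hH : ContDiff ℝ 2 H) (hreg : ZeroIsRegularValue H)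
    {π : E n → E n} (hπ : IsNearestProj (feasible H) π) {γ β₀ β σ : ℝ} (hγ : 0 < γ)
    (hβ₀ : 0 < β₀) (hβ : β ∈ Ioo (0 : ℝ) 1) (hσ : σ ∈ Ioo (0 : ℝ) 1)
    {a : E n} (ha : a ∈ feasible H) (hcrit : ¬ IsParetoCritical F H a) :
    ∃ d > 0, ∀ᶠ x in 𝓝 a, x ∈ feasible H → ∀ v y, Step F H π γ β₀ β σ x v y →
      ∀ i, F y i ≤ F x i - d := by
  obtain ⟨c, hc, δ, hδ, hev⟩ := eventually_armijo hm hF hH hreg hπ hγ hσ.2 ha hcrit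
  have hmin : 0 < min β₀ (β * δ) := lt_min hβ₀ (mul_pos hβ.1 hδ)
  refine ⟨σ * min β₀ (β * δ) * c, mul_pos (mul_pos hσ.1 hmin) hc, ?_⟩
  filter_upwards [hev] with x hx hxM v y hstep i
  obtain ⟨-, hv, t, ht, rfl⟩ := hstep
  obtain ⟨hdesc, harm⟩ := hx hxM v hv
  have hle := ht.le hβ₀ hβ harm
  obtain ⟨k, hk, rfl⟩ := ht
  have h1 := hk.1 i
  have h2 : σ * min β₀ (β * δ) * c ≤ σ * (β₀ * β ^ k) * c := by
    have := hσ.1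
    gcongr
  have h3 : σ * (β₀ * β ^ k) * (fderiv ℝ F x v) i ≤ σ * (β₀ * β ^ k) * (-c) :=
    mul_le_mul_of_nonneg_left (hdesc i) (mul_nonneg hσ.1.le (hmin.le.trans hle))
  linarith

end EqMOP

/-! ### Convergence. -/

theorem mainTheorem1 {n m mH : ℕ} (hm : 1 ≤ m)
    (F : EqMOP.E n → EqMOP.E m) (H : EqMOP.E n → EqMOP.E mH)
    (hF : ContDiff ℝ 2 F) (hH : ContDiff ℝ 2 H) (hreg : EqMOP.ZeroIsRegularValue H)
    (π : EqMOP.E n → EqMOP.E n) (hπ : EqMOP.IsNearestProj (EqMOP.feasible H) π)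
    (γ β₀ β σ : ℝ) (hγ : γ ∈ Set.Ioc (0 : ℝ) 1) (hβ₀ : 0 < β₀)
    (hβ : β ∈ Set.Ioo (0 : ℝ) 1) (hσ : σ ∈ Set.Ioo (0 : ℝ) 1)
    (xin : EqMOP.E n) (N : ℕ∞) (x v : ℕ → EqMOP.E n)
    (hrun : EqMOP.IsRun F H π γ β₀ β σ xin N x v) :
    (∃ L : ℕ, N = (L : ℕ∞) ∧ EqMOP.IsParetoCritical F H (x L)) ∨
      (N = ⊤ ∧ ∀ xbar : EqMOP.E n, MapClusterPt xbar Filter.atTop x →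
        EqMOP.IsParetoCritical F H xbar) := by
  have hfeas : ∀ l : ℕ, (l : ℕ∞) ≤ N → x l ∈ EqMOP.feasible H := by
    intro l hl
    rcases l with _ | l
    · rw [hrun.init]; exact (hπ _).1
    · obtain ⟨-, -, t, -, h⟩ := hrun.step l
        (lt_of_lt_of_le (by exact_mod_cast Nat.lt_succ_self l) hl)
      rw [h]; exact (hπ _).1
  induction N using ENat.recTopCoe with
  | top =>
    refine Or.inr ⟨rfl, fun xbar hcl => ?_⟩
    have hstep := fun l : ℕ => hrun.step l (ENat.natCast_lt_top l)
    have hfeas' := fun l : ℕ => hfeas l le_top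
    have hxbar : xbar ∈ EqMOP.feasible H := by
      have hclosed : IsClosed (EqMOP.feasible H) := isClosed_eq hH.continuous continuous_const
      by_contra hcon
      obtain ⟨l, hl⟩ := (hcl.frequently (hclosed.isOpen_compl.mem_nhds hcon)).exists
      exact hl (hfeas' l)
    by_contra hcrit
    obtain ⟨d, hd, hev⟩ := EqMOP.eventually_step_le hm hF hH hreg hπ hγ.1 hβ₀ hβ hσ hxbar hcrit
    set i₀ : Fin m := ⟨0, hm⟩
    have hanti : Antitone fun l => F (x l) i₀ :=
      antitone_nat_of_succ_le fun l => ((hstep l).lt hm hγ.1 hβ₀ hβ.1 hσ.1 i₀).le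
    have hcont : Continuous fun y => F y i₀ :=
      (EuclideanSpace.proj (𝕜 := ℝ) i₀).continuous.comp hF.continuous
    -- Were some value below `F xbar i₀`, monotonicity would keep all later ones away from it.
    have hlow : ∀ l, F xbar i₀ ≤ F (x l) i₀ := by
      intro l
      by_contra hcon
      push Not at hcon
      obtain ⟨k, hk, hkl⟩ := ((hcl.frequently ((hcont.tendsto xbar).eventually
        (lt_mem_nhds hcon))).and_eventually (Filter.eventually_ge_atTop l)).exists
      exact absurd (hanti hkl) (not_le.2 hk)
    have hnear : ∀ᶠ y in 𝓝 xbar, F y i₀ < F xbar i₀ + d :=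
      (hcont.tendsto xbar).eventually (gt_mem_nhds (by linarith))
    obtain ⟨l, hl, hl'⟩ := (hcl.frequently (hev.and hnear)).exists
    have h1 := hl (hfeas' l) _ _ (hstep l) i₀
    linarith [hlow (l + 1)]
  | coe L =>
    refine Or.inl ⟨L, rfl, ?_⟩
    -- At a noncritical last iterate a direction and a step length both exist, so a further
    -- iteration is possible, against maximality.
    by_contra hcrit
    have hv := hrun.direction L le_rfl (EqMOP.exists_isApproxSol hm F H hγ.2 (x L))
    obtain ⟨c, hc, δ, hδ, hev⟩ := EqMOP.eventually_armijo hm hF hH hreg hπ hγ.1 hσ.2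
      (hfeas L le_rfl) hcrit
    obtain ⟨t, ht⟩ := EqMOP.exists_isStepLength hβ₀ hβ hδ
      (hev.self_of_nhds (hfeas L le_rfl) _ hv).2
    exact hrun.maximal L rfl ⟨_, hcrit, hv, t, ht, rfl⟩
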